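/- Let $\mathbb{F}_q$ be a finite field, $\mathbb{F}_{q^m}$ its extension of degree $m$, and let $l,k,n$ be integers with $1\le l\le k\le n$ and $m\ge l+n$. For $x,y\in\mathbb{F}_{q^m}^N$ let $d_R(x,y)$ be the $\mathbb{F}_q$-dimension of the $\mathbb{F}_q$-span of the coordinates of $y-x$; a linear code $C\subseteq\mathbb{F}_{q^m}^N$ is MRD if its minimum distance satisfies $d_R(C)=\min\{1,m/N\}(N-\dim C)+1$. Let $D\subseteq\mathbb{F}_{q^m}^{l+n}$ be an $[l+n,k]$ MRD code with a systematic generator matrix $G=[\,I\;\;P\,]\in\mathbb{F}_{q^m}^{k\times(l+n)}$. Let $\Delta G\in\mathbb{F}_{q^m}^{l\times n}$ consist of the first $l$ rows and last $n$ columns of $G$. Let $C_1\subseteq\mathbb{F}_{q^m}^n$ be $D$ punctured to its last $n$ coordinates (the projection of $D$ onto them), and let $C_2\subseteq C_1$ be $D$ shortened to its last $n$ coordinates (the projection of the codewords of $D$ whose first $l$ coordinates vanish). Consider the nested coset coding scheme that encodes a message $S\in\mathbb{F}_{q^m}^l$ into a random element $X$ of the coset $\psi(S)$, where $\psi:\mathbb{F}_{q^m}^l\to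 C_1/C_2$ is the linear bijection $\psi(S)=S\,\Delta G+C_2$. For $S=(S_1,\dots,S_l)$ uniform on $\mathbb{F}_{q^m}^l$ and $X$ conditionally uniform on $\psi(S)$ given $S$, the scheme is called universally $\alpha$-strong ($\alpha\ge 0$ an integer) if $I(S_{\mathcal Z};BX^{\mathrm T})=0$ for every $\mathcal Z\subseteq\{1,\dots,l\}$ with $|\mathcal Z|\le\alpha+1$ and every $B\in\mathbb{F}_q^{(\alpha-|\mathcal Z|+1)\times n}$, where $S_{\mathcal Z}=(S_i)_{i\in\mathcal Z}$ and $I$ is mutual information (logarithms to base $q^m$). The universal maximum strength $\Omega$ of the scheme is the largest $\alpha$ for which it is universally $\alpha$-strong. Then this maximum exists and $$\Omega = k-1=\dim C_1-1 .$$ -/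

import Mathlib

open scoped ENNReal

/-! ## Rank-metric codes

`F` plays the role of `𝔽_q`, `K` of `𝔽_{q^m}`, so `m = Module.finrank F K`.  A linear code of length
`N` is a `K`-subspace of `Fin N → K`. -/

/-- The rank distance `d_R(x, y)`: the `F`-dimension of the subspace of `K` spanned by the
coordinates of `y - x`. -/
noncomputable def rankDist (F : Type*) {K : Type*} [Field F] [Field K] [Algebra F K] {N : ℕ}
    (x y : Fin N → K) : ℕ :=
  Module.finrank F (Submodule.span F (Set.range (y - x)))

/-- The minimum rank distance `d_R(C)` of a linear code with at least two codewords
(the value for the zero code is the junk value `0`). -/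
noncomputable def minRankDist (F : Type*) {K : Type*} [Field F] [Field K] [Algebra F K] {N : ℕ}
    (C : Submodule K (Fin N → K)) : ℕ :=
  sInf {d | ∃ x ∈ C, ∃ y ∈ C, x ≠ y ∧ rankDist F x y = d}

/-- A code is maximum rank distance (MRD) if it attains the Singleton-type bound
`d_R(C) ≤ min {1, m / N} * (N - dim C) + 1`. -/
def IsMRD (F : Type*) {K : Type*} [Field F] [Field K] [Algebra F K] {N : ℕ}
    (C : Submodule K (Fin N → K)) : Prop :=
  (minRankDist F C : ℚ) =
    min 1 ((Module.finrank F K : ℚ) / N) * ((N : ℚ) - Module.finrank K C) + 1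

/-- `G = [I P]` is a systematic generator matrix of the code `C`: the rows of `G` span `C` and the
first `k` columns of `G` form the identity matrix (so `dim C = k`). -/
structure IsSystematicGenerator {K : Type*} [Field K] {k N : ℕ}
    (G : Matrix (Fin k) (Fin N) K) (C : Submodule K (Fin N → K)) : Prop where
  le : k ≤ N
  span_rows : Submodule.span K (Set.range fun i => G i) = C
  identity : ∀ (i : Fin k) (j : Fin N), (j : ℕ) < k → G i j = if (i : ℕ) = j then 1 else 0

/-- The code punctured to the index set enumerated by `e`: the coordinates outside the range of `e`
are deleted from all codewords. -/
def puncture {K : Type*} [Field K] {N n : ℕ} (C : Submodule K (Fin N → K)) (e : Fin n ↪ Fin N) :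
    Submodule K (Fin n → K) :=
  C.map (LinearMap.funLeft K K e)

/-- The code shortened to the index set enumerated by `e`: one keeps the codewords vanishing outside
the range of `e` and deletes the coordinates outside the range of `e`. -/
def shorten {K : Type*} [Field K] {N n : ℕ} (C : Submodule K (Fin N → K)) (e : Fin n ↪ Fin N) :
    Submodule K (Fin n → K) :=
  (C ⊓ ⨅ i ∈ (Set.range e)ᶜ, LinearMap.ker (LinearMap.proj i : (Fin N → K) →ₗ[K] K)).map
    (LinearMap.funLeft K K e)

/-! ## Mutual information -/

/-- The joint law of two independent variables with laws `p` and `r`. -/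
noncomputable def indepProd {α β : Type*} (p : PMF α) (r : PMF β) : PMF (α × β) :=
  p.bind fun a => r.map (Prod.mk a)

/-- The mutual information `I(U; V)`, with logarithms to base `b`, of a pair `(U, V)` of discrete
random variables with joint law `p`: the relative entropy of the joint law with respect to the
product of the marginal laws. -/
noncomputable def mutualInfo {α β : Type*} (b : ℝ) (p : PMF (α × β)) : ℝ≥0∞ :=
  @InformationTheory.klDiv (α × β) ⊤ (@PMF.toMeasure (α × β) ⊤ p)
    (@PMF.toMeasure (α × β) ⊤ (indepProd (p.map Prod.fst) (p.map Prod.snd))) /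
    ENNReal.ofReal (Real.log b)

/-! ## Nested coset coding -/

/-- A nested coset coding scheme for secret messages `S ∈ K^l` and transmitted vectors `X ∈ K^n`:
`S` is encoded by a random element `X` of the coset `ψ S ∈ C₁ / C₂`. -/
structure NestedCosetScheme (K : Type*) [Field K] (l n : ℕ) where
  C₁ : Submodule K (Fin n → K)
  C₂ : Submodule K (Fin n → K)
  lt : C₂ < C₁
  finrank_add : Module.finrank K C₂ + l = Module.finrank K C₁
  ψ : (Fin l → K) ≃ₗ[K] (C₁ ⧸ C₂.submoduleOf C₁)

namespace NestedCosetScheme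

variable {K : Type*} [Field K] {l n : ℕ}

open Classical in
/-- The coset `ψ S` as a finite set of vectors. -/
noncomputable def coset [Fintype K] (E : NestedCosetScheme K l n) (S : Fin l → K) :
    Finset (Fin n → K) :=
  {x : Fin n → K | ∃ h : x ∈ E.C₁, Submodule.Quotient.mk ⟨x, h⟩ = E.ψ S}

theorem coset_nonempty [Fintype K] (E : NestedCosetScheme K l n) (S : Fin l → K) :
    (E.coset S).Nonempty := by
  classical
  obtain ⟨x, hx⟩ := Submodule.Quotient.mk_surjective _ (E.ψ S)
  exact ⟨x.1, by simp only [coset, Finset.mem_filter]; exact ⟨Finset.mem_univ _, x.2, hx⟩⟩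

/-- The joint law of `(S, X)` for `S` uniform on `K^l` and `X` conditionally uniform on `ψ S`. -/
noncomputable def uniformLaw [Fintype K] (E : NestedCosetScheme K l n) :
    PMF ((Fin l → K) × (Fin n → K)) :=
  (PMF.uniformOfFintype (Fin l → K)).bind fun S =>
    (PMF.uniformOfFinset (E.coset S) (E.coset_nonempty S)).map (Prod.mk S)

/-- The leakage `I(S_Z; B Xᵀ)`, computed with logarithms to base `|K| = q^m`, for uniform `S` and
conditionally uniform `X`. -/
noncomputable def leakage {F : Type*} [Field F] [Algebra F K] [Fintype K]
    (E : NestedCosetScheme K l n) (Z : Finset (Fin l)) {μ : ℕ} (B : Matrix (Fin μ) (Fin n) F) :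
    ℝ≥0∞ :=
  mutualInfo (Fintype.card K : ℝ) (E.uniformLaw.map fun SX =>
    ((fun i : Z => SX.1 i), (B.map (algebraMap F K)).mulVec SX.2))

/-- Universal `α`-strong security: `I(S_Z; B Xᵀ) = 0` for every `Z ⊆ {1, …, l}` and every matrix `B`
over `F` with `n` columns and exactly `α - |Z| + 1` rows. -/
def IsUniversallyStrong (F : Type*) [Field F] [Algebra F K] [Fintype K]
    (E : NestedCosetScheme K l n) (α : ℕ) : Prop :=
  ∀ (Z : Finset (Fin l)) (μ : ℕ), μ + Z.card = α + 1 →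
    ∀ B : Matrix (Fin μ) (Fin n) F, E.leakage Z B = 0

/-- `Ω` is the universal maximum strength: the maximum of all `α` for which the scheme attains
universal `α`-strong security. -/
def IsUniversalMaxStrength (F : Type*) [Field F] [Algebra F K] [Fintype K]
    (E : NestedCosetScheme K l n) (Ω : ℕ) : Prop :=
  IsGreatest {α : ℕ | E.IsUniversallyStrong F α} Ω

end NestedCosetScheme

/-! ## The explicit scheme -/

section Explicit

variable {F K : Type*} [Field F] [Field K] [Algebra F K] {l n k : ℕ}
  {D : Submodule K (Fin (l + n) → K)} {G : Matrix (Fin k) (Fin (l + n)) K}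

/-- The `l × n` block `ΔG` of `G`: the first `l` rows and the last `n` columns. -/
def deltaBlock (hlk : l ≤ k) (G : Matrix (Fin k) (Fin (l + n)) K) : Matrix (Fin l) (Fin n) K :=
  G.submatrix (Fin.castLE hlk) (Fin.natAdd l)

theorem IsSystematicGenerator.finrank_eq {N : ℕ} {C : Submodule K (Fin N → K)}
    {G : Matrix (Fin k) (Fin N) K} (hG : IsSystematicGenerator G C) :
    Module.finrank K C = k := by
  rw [← hG.span_rows, finrank_span_eq_card, Fintype.card_fin]
  rw [Fintype.linearIndependent_iff]
  intro g hg i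
  have h := congrFun hg (Fin.castLE hG.le i)
  simpa [Finset.sum_apply, hG.identity, Fin.val_inj] using h

theorem IsSystematicGenerator.exists_codeword (hG : IsSystematicGenerator G D) (hlk : l ≤ k)
    (S : Fin l → K) : ∃ g ∈ D, (∀ i, g (Fin.castAdd n i) = S i) ∧
      ∀ j, g (Fin.natAdd l j) = Matrix.vecMul S (deltaBlock hlk G) j := by
  refine ⟨∑ i, S i • G (Fin.castLE hlk i), ?_, fun i => ?_, fun j => ?_⟩
  · refine Submodule.sum_mem _ fun i _ => Submodule.smul_mem _ _ ?_
    rw [← hG.span_rows]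
    exact Submodule.subset_span ⟨_, rfl⟩
  · have : ∀ x : Fin l, G (Fin.castLE hlk x) (Fin.castAdd n i) = if x = i then 1 else 0 := by
      intro x
      rw [hG.identity _ _ (by simpa using i.2.trans_le hlk)]
      simp [Fin.ext_iff]
    simp [Finset.sum_apply, this]
  · simp [Finset.sum_apply, Matrix.vecMul, dotProduct, deltaBlock]

theorem vecMul_deltaBlock_mem (hG : IsSystematicGenerator G D) (hlk : l ≤ k) (S : Fin l → K) :
    Matrix.vecMulLinear (deltaBlock hlk G) S ∈ puncture D (Fin.natAddEmb l) := by
  obtain ⟨g, hg, -, h⟩ := hG.exists_codeword hlk S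
  exact ⟨g, hg, funext h⟩

/-- The map `S ↦ S ΔG + C₂`, where `C₁` is `D` punctured and `C₂` is `D` shortened to the last `n`
coordinates. -/
def proposedMap (hG : IsSystematicGenerator G D) (hlk : l ≤ k) :
    (Fin l → K) →ₗ[K] (puncture D (Fin.natAddEmb l) ⧸
      (shorten D (Fin.natAddEmb l)).submoduleOf (puncture D (Fin.natAddEmb l))) :=
  (Submodule.mkQ _).comp
    ((Matrix.vecMulLinear (deltaBlock hlk G)).codRestrict _ (vecMul_deltaBlock_mem hG hlk))

theorem mem_shorten_natAdd {x : Fin n → K} : x ∈ shorten D (Fin.natAddEmb l) ↔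
    ∃ c ∈ D, (∀ i, c (Fin.castAdd n i) = 0) ∧ ∀ j, c (Fin.natAdd l j) = x j := by
  have key : ∀ c : Fin (l + n) → K, (∀ i, i ∈ (Set.range (Fin.natAddEmb (m := n) l))ᶜ → c i = 0) ↔
      ∀ i, c (Fin.castAdd n i) = 0 := by
    intro c
    constructor
    · intro h i
      refine h _ ?_
      rintro ⟨j, hj⟩
      have := congrArg Fin.val hj
      simp at this
      omega
    · intro h i
      refine Fin.addCases (fun i _ => h i) (fun j hj => (hj ⟨j, rfl⟩).elim) i
  simp only [shorten, Submodule.mem_map, Submodule.mem_inf, Submodule.mem_iInf,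
    LinearMap.mem_ker, LinearMap.proj_apply, key, and_assoc]
  refine exists_congr fun c => and_congr_right fun _ => and_congr_right fun _ => ?_
  exact funext_iff

theorem shorten_le_puncture : shorten D (Fin.natAddEmb l) ≤ puncture D (Fin.natAddEmb l) :=
  Submodule.map_mono inf_le_left

theorem proposedMap_surjective (hG : IsSystematicGenerator G D) (hlk : l ≤ k) :
    Function.Surjective (proposedMap hG hlk) := by
  intro y
  obtain ⟨⟨x, c, hc, rfl⟩, rfl⟩ := Submodule.Quotient.mk_surjective _ y
  obtain ⟨g, hg, h1, h2⟩ := hG.exists_codeword hlk fun i => c (Fin.castAdd n i)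
  refine ⟨fun i => c (Fin.castAdd n i), ?_⟩
  refine (Submodule.Quotient.eq _).2 ?_
  rw [Submodule.submoduleOf, Submodule.mem_comap]
  refine mem_shorten_natAdd.2 ⟨g - c, D.sub_mem hg hc, fun i => by simp [h1], fun j => ?_⟩
  simp only [Pi.sub_apply, h2]
  rfl

theorem proposedMap_injective (hlk : l ≤ k) (hkn : k ≤ n) (hm : l + n ≤ Module.finrank F K)
    (hG : IsSystematicGenerator G D) (hD : IsMRD F D) :
    Function.Injective (proposedMap hG hlk) := by
  rw [injective_iff_map_eq_zero]
  intro S hS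
  have hS' := (Submodule.Quotient.mk_eq_zero _).1 hS
  rw [Submodule.submoduleOf, Submodule.mem_comap] at hS'
  obtain ⟨c, hc, h1, h2⟩ := mem_shorten_natAdd.1 hS'
  obtain ⟨g, hg, h3, h4⟩ := hG.exists_codeword hlk S
  by_contra hne
  have hw1 : ∀ i, (g - c) (Fin.castAdd n i) = S i := fun i => by simp [h1, h3]
  have hw2 : ∀ j, (g - c) (Fin.natAdd l j) = 0 := fun j => by
    rw [Pi.sub_apply, h2, h4, sub_eq_zero]
    rfl
  have hcg : c ≠ g := by
    rintro rfl
    exact hne (funext fun i => by rw [← hw1]; simp)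
  have hle : minRankDist F D ≤ rankDist F c g := Nat.sInf_le ⟨c, hc, g, hg, hcg, rfl⟩
  have hrank : rankDist F c g ≤ l := by
    have hsub : Submodule.span F (Set.range (g - c)) ≤ Submodule.span F (Set.range S) := by
      rw [Submodule.span_le]
      rintro _ ⟨i, rfl⟩
      refine Fin.addCases (fun i => ?_) (fun j => ?_) i
      · rw [hw1]; exact Submodule.subset_span ⟨i, rfl⟩
      · rw [hw2]; exact Submodule.zero_mem _
    have hfin : Module.Finite F (Submodule.span F (Set.range S)) :=
      Module.Finite.span_of_finite F (Set.finite_range S)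
    refine (Submodule.finrank_mono hsub).trans ?_
    exact (finrank_range_le_card (R := F) S).trans (by simp)
  have hmin : min 1 ((Module.finrank F K : ℚ) / ((l + n : ℕ) : ℚ)) = 1 ∨ l + n = 0 := by
    rcases Nat.eq_zero_or_pos (l + n) with h | h
    · exact Or.inr h
    · left
      rw [min_eq_left]
      rw [le_div_iff₀ (by exact_mod_cast h), one_mul]
      exact_mod_cast hm
  rcases hmin with hmin | h0
  · rw [IsMRD, hmin, hG.finrank_eq] at hD
    have h5 : (minRankDist F D : ℚ) ≤ l := by exact_mod_cast hle.trans hrank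
    have h6 : (k : ℚ) ≤ n := by exact_mod_cast hkn
    push_cast at hD
    linarith
  · have : l = 0 := by omega
    subst this
    exact hne (Subsingleton.elim _ _)

theorem finrank_shorten_add (hlk : l ≤ k) (hkn : k ≤ n) (hm : l + n ≤ Module.finrank F K)
    (hG : IsSystematicGenerator G D) (hD : IsMRD F D) :
    Module.finrank K (shorten D (Fin.natAddEmb (m := n) l)) + l =
      Module.finrank K (puncture D (Fin.natAddEmb (m := n) l)) := by
  have h1 := (LinearEquiv.ofBijective (proposedMap hG hlk)
    ⟨proposedMap_injective hlk hkn hm hG hD, proposedMap_surjective hG hlk⟩).finrank_eq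
  have h2 := Submodule.finrank_quotient_add_finrank
    ((shorten D (Fin.natAddEmb l)).submoduleOf (puncture D (Fin.natAddEmb l)))
  have h3 := (Submodule.submoduleOfEquivOfLe (shorten_le_puncture (D := D))).finrank_eq
  rw [Module.finrank_fintype_fun_eq_card, Fintype.card_fin] at h1
  rw [← h1, h3] at h2
  rw [← h2, add_comm]

theorem shorten_lt_puncture (hl : 1 ≤ l) (hlk : l ≤ k) (hkn : k ≤ n)
    (hm : l + n ≤ Module.finrank F K) (hG : IsSystematicGenerator G D) (hD : IsMRD F D) :
    shorten D (Fin.natAddEmb (m := n) l) < puncture D (Fin.natAddEmb (m := n) l) := by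
  refine lt_of_le_of_ne shorten_le_puncture fun h => ?_
  have hfin := finrank_shorten_add hlk hkn hm hG hD
  rw [h] at hfin
  omega

/-- The explicit nested coset coding scheme built from an `[l + n, k]` MRD code `D` with systematic
generator matrix `G`: `C₁` is `D` punctured to the last `n` coordinates, `C₂` is `D` shortened to the
last `n` coordinates, and `ψ(S) = S ΔG + C₂`. -/
noncomputable def proposedScheme (hl : 1 ≤ l) (hlk : l ≤ k) (hkn : k ≤ n)
    (hm : l + n ≤ Module.finrank F K) (hG : IsSystematicGenerator G D) (hD : IsMRD F D) :
    NestedCosetScheme K l n where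
  C₁ := puncture D (Fin.natAddEmb l)
  C₂ := shorten D (Fin.natAddEmb l)
  lt := shorten_lt_puncture hl hlk hkn hm hG hD
  finrank_add := finrank_shorten_add hlk hkn hm hG hD
  ψ := LinearEquiv.ofBijective (proposedMap hG hlk)
    ⟨proposedMap_injective hlk hkn hm hG hD, proposedMap_surjective hG hlk⟩

end Explicit

/-! ## Linear images of uniform variables -/

/-! The pair `(S, X)` is a uniform codeword of `D` cut into its first `l` and last `n` coordinates
(`uniformLaw_proposedScheme`). So `S_Z` and `B Xᵀ` are linear images of one uniform variable, and
they are independent exactly when the kernel of the second map already attains every value of the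
first (`leakage_proposedScheme_eq_zero_iff`).

Since `l + n ≤ m`, a nonzero codeword of `D` has rank at least `l + n - k + 1`, so its coordinates
satisfy at most `k - 1` independent relations over `F` (`IsMRD.eq_zero_of_relations`). Both bounds
follow. If `|Z| + μ = k`, reading `S_Z` together with `μ` independent `F`-combinations of `X` is
injective on the `k`-dimensional code, hence bijective, and `S_Z` stays free when the observation is
zero. If `α ≥ k`, observing `k` coordinates of `X` determines the codeword, so even one message
symbol leaks. -/

theorem mutualInfo_eq_zero_iff {α β : Type*} (b : ℝ) (p : PMF (α × β)) :
    mutualInfo b p = 0 ↔ p = indepProd (p.map Prod.fst) (p.map Prod.snd) := by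
  let _ : MeasurableSpace (α × β) := ⊤
  have : MeasurableSingletonClass (α × β) := ⟨fun _ => trivial⟩
  -- In `ℝ≥0∞` a quotient by a finite number, even by `0`, vanishes only if its numerator does, so
  -- the base is arbitrary.
  have hlog : ENNReal.ofReal (Real.log b) ≠ ∞ := ENNReal.ofReal_ne_top
  unfold mutualInfo
  rw [ENNReal.div_eq_zero_iff, or_iff_left hlog, InformationTheory.klDiv_eq_zero_iff,
    PMF.toMeasure_inj]

theorem indepProd_apply {α β : Type*} (p : PMF α) (r : PMF β) (a : α) (b : β) :
    indepProd p r (a, b) = p a * r b := by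
  classical
  rw [indepProd, PMF.bind_apply, tsum_eq_single a]
  · congr 1
    rw [PMF.map_apply, tsum_eq_single b]
    · simp
    · intro b' hb'
      simp [hb'.symm]
  · intro a' ha'
    rw [PMF.map_apply]
    simp [ha'.symm]

open Classical in
theorem map_uniformOfFintype_apply {G α : Type*} [Fintype G] [Nonempty G] (f : G → α) (a : α) :
    (PMF.uniformOfFintype G).map f a =
      (Finset.card {g | f g = a} : ℝ≥0∞) * (Fintype.card G : ℝ≥0∞)⁻¹ := by
  rw [PMF.map_apply, tsum_fintype]
  simp [Finset.sum_ite, eq_comm]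

open Classical in
/-- If every value of `φ` is attained on the kernel of `ψ`, then `φ` and `ψ` are independent for the
uniform distribution. -/
theorem card_fiber_mul_card {G A B : Type*} [AddCommGroup G] [Fintype G] [AddCommGroup A]
    [AddCommGroup B] (φ : G →+ A) (ψ : G →+ B) (h : ∀ g, ∃ g', φ g' = φ g ∧ ψ g' = 0)
    (a : A) (b : B) :
    Finset.card {g | φ g = a ∧ ψ g = b} * Fintype.card G =
      Finset.card {g | φ g = a} * Finset.card {g | ψ g = b} := by
  by_cases ha : ∃ g₀, φ g₀ = a
  · obtain ⟨g₀, rfl⟩ := ha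
    have hfib : ∀ g : G, Finset.card {x | φ x = φ g ∧ ψ x = b} =
        Finset.card {x | φ x = φ g₀ ∧ ψ x = b} := by
      intro g
      -- Translation by `t`, which lies in the kernel of `ψ`, moves the fibre of `φ` through `g` to
      -- the one through `g₀` without changing `ψ`.
      obtain ⟨t, ht, ht'⟩ := h (g₀ - g)
      refine Finset.card_equiv (Equiv.addRight t) fun x => ?_
      simp only [Finset.mem_filter, Finset.mem_univ, true_and, Equiv.coe_addRight, map_add, ht,
        ht', map_sub, add_zero]
      refine and_congr_left fun _ => ?_
      rw [← add_sub_assoc, sub_eq_iff_eq_add, add_comm (φ g₀), add_left_inj]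
    have hfib' : ∀ g : G, Finset.card {x | φ x = φ g} = Finset.card {x | φ x = φ g₀} := by
      intro g
      refine Finset.card_equiv (Equiv.addRight (g₀ - g)) fun x => ?_
      simp only [Finset.mem_filter, Finset.mem_univ, true_and, Equiv.coe_addRight, map_add,
        map_sub]
      rw [← add_sub_assoc, sub_eq_iff_eq_add, add_comm (φ g₀), add_left_inj]
    -- Double count of the pairs `(g, x)` with `φ x = φ g` and `ψ x = b`.
    calc Finset.card {g | φ g = φ g₀ ∧ ψ g = b} * Fintype.card G
        = ∑ g : G, Finset.card {x | φ x = φ g ∧ ψ x = b} := by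
          simp [hfib, mul_comm]
      _ = ∑ g : G, ∑ x : G, if φ x = φ g ∧ ψ x = b then 1 else 0 := by
          simp only [Finset.card_filter]
      _ = ∑ x : G, ∑ g : G, if φ x = φ g ∧ ψ x = b then 1 else 0 := Finset.sum_comm
      _ = ∑ x : G, if ψ x = b then Finset.card {g | φ g = φ x} else 0 := by
          refine Finset.sum_congr rfl fun x _ => ?_
          by_cases hx : ψ x = b <;> simp [hx, eq_comm]
      _ = Finset.card {g | φ g = φ g₀} * Finset.card {g | ψ g = b} := by
          simp [hfib', ← Finset.sum_filter, mul_comm]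
  · have h0 : ∀ g, φ g ≠ a := fun g hg => ha ⟨g, hg⟩
    simp [h0]

/-- Two homomorphic images of a uniform variable on a finite group have zero mutual information if
and only if every value of the first one is attained on the kernel of the second one. -/
theorem mutualInfo_map_uniform_eq_zero_iff {G A B : Type*} [AddCommGroup G] [Fintype G]
    [AddCommGroup A] [AddCommGroup B] (b : ℝ) (φ : G →+ A) (ψ : G →+ B) :
    mutualInfo b ((PMF.uniformOfFintype G).map fun g => (φ g, ψ g)) = 0 ↔
      ∀ g, ∃ g', φ g' = φ g ∧ ψ g' = 0 := by
  classical
  rw [mutualInfo_eq_zero_iff b, PMF.map_comp, PMF.map_comp]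
  have hcard : (Fintype.card G : ℝ≥0∞) ≠ 0 := by simp
  have hcard' : (Fintype.card G : ℝ≥0∞) ≠ ∞ := by simp
  constructor
  · intro h g
    by_contra hg
    push Not at hg
    -- The joint law gives `(φ g, 0)` no mass, while both marginals are positive there: `ψ` takes
    -- the value `0` at the identity.
    have h1 := DFunLike.congr_fun h (φ g, 0)
    rw [indepProd_apply] at h1
    have h2 : ((PMF.uniformOfFintype G).map fun g => (φ g, ψ g)) (φ g, 0) = 0 := by
      rw [PMF.apply_eq_zero_iff, PMF.mem_support_map_iff]
      rintro ⟨x, -, hx⟩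
      exact hg x (congrArg Prod.fst hx) (congrArg Prod.snd hx)
    rw [h2, eq_comm, mul_eq_zero, PMF.apply_eq_zero_iff, PMF.apply_eq_zero_iff,
      PMF.mem_support_map_iff, PMF.mem_support_map_iff] at h1
    rcases h1 with h1 | h1
    · exact h1 ⟨g, by simp, rfl⟩
    · exact h1 ⟨0, by simp, by simp⟩
  · intro h
    ext ⟨x, y⟩
    rw [indepProd_apply, map_uniformOfFintype_apply, map_uniformOfFintype_apply,
      map_uniformOfFintype_apply]
    have key : (Finset.card {g | φ g = x ∧ ψ g = y} : ℝ≥0∞) * Fintype.card G =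
      Finset.card {g | φ g = x} * Finset.card {g | ψ g = y} := by
      exact_mod_cast card_fiber_mul_card φ ψ h x y
    simp only [Prod.mk.injEq, Function.comp_apply]
    rw [mul_mul_mul_comm, ← key, mul_assoc, ← mul_assoc (Fintype.card G : ℝ≥0∞),
      ENNReal.mul_inv_cancel hcard hcard', one_mul]

/-! ## Relations among the coordinates of MRD codewords -/

theorem Submodule.exists_le_finrank_eq {F V : Type*} [Field F] [AddCommGroup V] [Module F V]
    [Module.Finite F V] (U : Submodule F V) {d : ℕ} (hU : Module.finrank F U ≤ d)
    (hd : d ≤ Module.finrank F V) : ∃ W, U ≤ W ∧ Module.finrank F W = d := by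
  induction d, hU using Nat.le_induction with
  | base => exact ⟨U, le_rfl, rfl⟩
  | succ d _ ih =>
    obtain ⟨W, hUW, rfl⟩ := ih (Nat.le_of_succ_le hd)
    obtain ⟨x, -, hx⟩ := SetLike.exists_of_lt (Submodule.lt_top_of_finrank_lt_finrank hd)
    refine ⟨W ⊔ Submodule.span F {x}, hUW.trans le_sup_left, ?_⟩
    exact finrank_sup_span_singleton hx

/-- For `N ≤ m` the factor `min {1, m / N}` is `1`, and the rank of `c` is its distance from the
zero codeword. The additive form avoids truncated subtraction. -/
theorem IsMRD.le_finrank_span {F K : Type*} [Field F] [Field K] [Algebra F K] {N : ℕ}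
    {C : Submodule K (Fin N → K)} (hC : IsMRD F C) (hN : N ≤ Module.finrank F K)
    {c : Fin N → K} (hc : c ∈ C) (hc0 : c ≠ 0) :
    N + 1 ≤ Module.finrank F (Submodule.span F (Set.range c)) + Module.finrank K C := by
  have hpos : 0 < N := Nat.pos_of_ne_zero (by rintro rfl; exact hc0 (Subsingleton.elim _ _))
  have hmin : min 1 ((Module.finrank F K : ℚ) / (N : ℚ)) = 1 := by
    rw [min_eq_left]
    rw [le_div_iff₀ (by exact_mod_cast hpos), one_mul]
    exact_mod_cast hN
  have hle : minRankDist F C ≤ Module.finrank F (Submodule.span F (Set.range c)) :=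
    Nat.sInf_le ⟨0, C.zero_mem, c, hc, hc0.symm, by rw [rankDist, sub_zero]⟩
  rw [IsMRD, hmin] at hC
  have h1 : (minRankDist F C : ℚ) ≤ Module.finrank F (Submodule.span F (Set.range c)) := by
    exact_mod_cast hle
  have h2 : (N : ℚ) + 1 ≤
      Module.finrank F (Submodule.span F (Set.range c)) + Module.finrank K C := by linarith
  exact_mod_cast h2

/-- A codeword of an MRD code `C` whose coordinates satisfy `dim C` independent relations over `F`
vanishes. -/
theorem IsMRD.eq_zero_of_relations {F K M : Type*} [Field F] [Field K] [Algebra F K]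
    [AddCommGroup M] [Module F M] {N : ℕ} {C : Submodule K (Fin N → K)} (hC : IsMRD F C)
    (hN : N ≤ Module.finrank F K) {c : Fin N → K} (hc : c ∈ C) (L : M →ₗ[F] (Fin N → F))
    (hL : Function.Injective L) (hM : Module.finrank K C ≤ Module.finrank F M)
    (h : ∀ v, ∑ j, L v j • c j = 0) : c = 0 := by
  by_contra hc0
  have h1 := hC.le_finrank_span hN hc hc0
  -- The relations among the coordinates are the kernel of this map and their span is its range, so
  -- rank-nullity leaves fewer than `dim C` relations.
  have h2 := (Fintype.linearCombination F c).finrank_range_add_finrank_ker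
  rw [Fintype.range_linearCombination, Module.finrank_fintype_fun_eq_card, Fintype.card_fin] at h2
  have h3 : LinearMap.range L ≤ LinearMap.ker (Fintype.linearCombination F c) := by
    rintro _ ⟨v, rfl⟩
    simpa [Fintype.linearCombination_apply] using h v
  have h4 := Submodule.finrank_mono h3
  rw [LinearMap.finrank_range_of_inj hL] at h4
  omega

section Relations

variable {F K : Type*} [Field F] [Field K] [Algebra F K] {l n k : ℕ}
  {D : Submodule K (Fin (l + n) → K)}

/-- A codeword of an MRD code vanishes if `dim D` of its last `n` coordinates vanish. -/
theorem IsMRD.eq_zero_of_natAdd_eq_zero (hD : IsMRD F D) (hm : l + n ≤ Module.finrank F K)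
    (hk : Module.finrank K D ≤ n) {c : Fin (l + n) → K} (hc : c ∈ D)
    (h : ∀ j : Fin n, (j : ℕ) < Module.finrank K D → c (Fin.natAdd l j) = 0) : c = 0 := by
  set k := Module.finrank K D with hkdef
  let L : (Fin k → F) →ₗ[F] (Fin (l + n) → F) :=
    { toFun := fun v => Fin.append 0 fun j => if hj : (j : ℕ) < k then v ⟨j, hj⟩ else 0
      map_add' := fun v w => by
        ext t
        refine Fin.addCases (fun i => by simp) (fun j => ?_) t
        by_cases hj : (j : ℕ) < k <;> simp [hj]
      map_smul' := fun a v => by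
        ext t
        refine Fin.addCases (fun i => by simp) (fun j => ?_) t
        by_cases hj : (j : ℕ) < k <;> simp [hj] }
  refine hD.eq_zero_of_relations hm hc L ?_ (by simp [hkdef]) fun v => ?_
  · intro v w hvw
    ext i
    have := congrFun hvw (Fin.natAdd l (Fin.castLE hk i))
    simpa [L] using this
  · rw [Fin.sum_univ_add]
    simp only [L, LinearMap.coe_mk, AddHom.coe_mk, Fin.append_left, Fin.append_right,
      Pi.zero_apply, zero_smul, Finset.sum_const_zero, zero_add]
    refine Finset.sum_eq_zero fun j _ => ?_
    by_cases hj : (j : ℕ) < k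
    · rw [h j hj, smul_zero]
    · rw [dif_neg hj, zero_smul]

/-- In an MRD code, the coordinates in `Z` may be prescribed together with the vanishing of
`dim D - |Z|` combinations over `F` of the last `n` coordinates. -/
theorem IsMRD.exists_codeword (hD : IsMRD F D) (hm : l + n ≤ Module.finrank F K)
    (hk : Module.finrank K D ≤ n) (Z : Finset (Fin l)) {μ : ℕ}
    (hμ : μ + Z.card = Module.finrank K D) (B : Matrix (Fin μ) (Fin n) F) (s : Z → K) :
    ∃ c ∈ D, (∀ i : Z, c (Fin.castAdd n i) = s i) ∧
      (B.map (algebraMap F K)).mulVec (fun j => c (Fin.natAdd l j)) = 0 := by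
  -- The rows of `B` may be dependent. Enlarging their span to dimension exactly `μ ≤ n` only asks
  -- for more vanishing, and makes the dimensions below match.
  obtain ⟨W, hBW, hW⟩ := (Submodule.span F (Set.range fun i => B i)).exists_le_finrank_eq
    (d := μ) ((finrank_range_le_card (R := F) fun i => B i).trans (by simp)) (by simp; omega)
  let b := Module.finBasisOfFinrankEq F W hW
  let Φ : D →ₗ[K] (Z → K) × (Fin μ → K) :=
    LinearMap.prod
      (LinearMap.funLeft K K (fun i : Z => Fin.castAdd n (i : Fin l)) ∘ₗ D.subtype)
      (((Matrix.of fun i j => algebraMap F K ((b i : Fin n → F) j)).mulVecLin ∘ₗ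
        LinearMap.funLeft K K (Fin.natAdd l)) ∘ₗ D.subtype)
  have hspan : ∀ c : Fin (l + n) → K, (∀ i, ∑ j, (b i : Fin n → F) j • c (Fin.natAdd l j) = 0) →
      ∀ w ∈ W, ∑ j, w j • c (Fin.natAdd l j) = 0 := by
    intro c hc w hw
    let T : W →ₗ[F] K :=
      Fintype.linearCombination F (fun j => c (Fin.natAdd l j)) ∘ₗ W.subtype
    have hT : T = 0 := b.ext fun i => by simpa [T, Fintype.linearCombination_apply] using hc i
    simpa [T, Fintype.linearCombination_apply] using LinearMap.congr_fun hT ⟨w, hw⟩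
  -- These relations are independent, as the two factors live on disjoint coordinate blocks; there
  -- are `|Z| + μ = dim D` of them.
  let L : ((Z → F) × W) →ₗ[F] (Fin (l + n) → F) :=
    { toFun := fun v => Fin.append (fun i => if hi : i ∈ Z then v.1 ⟨i, hi⟩ else 0) (v.2 : Fin n → F)
      map_add' := fun v w => by
        ext t
        refine Fin.addCases (fun i => ?_) (fun j => by simp) t
        by_cases hi : i ∈ Z <;> simp [hi]
      map_smul' := fun a v => by
        ext t
        refine Fin.addCases (fun i => ?_) (fun j => by simp) t
        by_cases hi : i ∈ Z <;> simp [hi] }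
  have hL : Function.Injective L := by
    intro v w hvw
    refine Prod.ext (funext fun i => ?_) (Subtype.ext (funext fun j => ?_))
    · simpa [L] using congrFun hvw (Fin.castAdd n (i : Fin l))
    · simpa [L] using congrFun hvw (Fin.natAdd l j)
  have hΦ : Function.Injective Φ := by
    rw [injective_iff_map_eq_zero]
    intro c hc
    have h1 : ∀ i : Z, c.1 (Fin.castAdd n (i : Fin l)) = 0 := fun i =>
      congrFun (congrArg Prod.fst hc) i
    have h2 : ∀ i, ∑ j, (b i : Fin n → F) j • c.1 (Fin.natAdd l j) = 0 := fun i => by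
      simpa [Φ, Matrix.mulVec, dotProduct, Algebra.smul_def] using
        congrFun (congrArg Prod.snd hc) i
    refine Subtype.ext (hD.eq_zero_of_relations hm c.2 L hL ?_ fun v => ?_)
    · rw [Module.finrank_prod, hW, Module.finrank_fintype_fun_eq_card, Fintype.card_coe]
      omega
    · rw [Fin.sum_univ_add]
      simp only [L, LinearMap.coe_mk, AddHom.coe_mk, Fin.append_left, Fin.append_right]
      rw [hspan c.1 h2 v.2 v.2.2, add_zero]
      refine Finset.sum_eq_zero fun i _ => ?_
      by_cases hi : i ∈ Z
      · rw [h1 ⟨i, hi⟩, smul_zero]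
      · rw [dif_neg hi, zero_smul]
  have hsurj : Function.Surjective Φ := by
    rwa [← LinearMap.injective_iff_surjective_of_finrank_eq_finrank]
    rw [Module.finrank_prod, Module.finrank_fintype_fun_eq_card,
      Module.finrank_fintype_fun_eq_card, Fintype.card_coe, Fintype.card_fin]
    omega
  obtain ⟨c, hc⟩ := hsurj (s, 0)
  refine ⟨c.1, c.2, fun i => congrFun (congrArg Prod.fst hc) i, funext fun i => ?_⟩
  have h2 : ∀ i, ∑ j, (b i : Fin n → F) j • c.1 (Fin.natAdd l j) = 0 := fun i => by
    simpa [Φ, Matrix.mulVec, dotProduct, Algebra.smul_def] using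
      congrFun (congrArg Prod.snd hc) i
  have h3 := hspan c.1 h2 (B i) (hBW (Submodule.subset_span ⟨i, rfl⟩))
  simpa [Matrix.mulVec, dotProduct, Algebra.smul_def] using h3

/-- Puncturing is injective on `D`: a codeword in its kernel has `n ≥ dim D` vanishing coordinates.
-/
theorem finrank_puncture (hm : l + n ≤ Module.finrank F K) (hD : IsMRD F D)
    (hk : Module.finrank K D ≤ n) :
    Module.finrank K (puncture D (Fin.natAddEmb (m := n) l)) = Module.finrank K D := by
  have hinj : Function.Injective (LinearMap.funLeft K K (Fin.natAddEmb (m := n) l) ∘ₗ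
      D.subtype) := by
    rw [injective_iff_map_eq_zero]
    intro c hc
    exact Subtype.ext (hD.eq_zero_of_natAdd_eq_zero hm hk c.2 fun j _ => congrFun hc j)
  rw [← LinearMap.finrank_range_of_inj hinj, LinearMap.range_comp, Submodule.range_subtype,
    puncture]

end Relations

/-! ## The joint law of the message and the transmitted vector -/

/-- Total mass `1` forces the two constants to agree. The law of `(S, X)` can thus be identified
from its support, without comparing the sizes of the cosets and of `D`. -/
theorem PMF.eq_of_support_eq_of_const {α : Type*} [Finite α] {p r : PMF α}
    (h : p.support = r.support) {a b : ℝ≥0∞} (hp : ∀ x ∈ p.support, p x = a)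
    (hr : ∀ x ∈ r.support, r x = b) : p = r := by
  classical
  obtain ⟨x₀, hx₀⟩ := p.support_nonempty
  have hsum : ∀ (t : PMF α) (d : ℝ≥0∞), t.support = p.support → (∀ x ∈ t.support, t x = d) →
      (p.support.ncard : ℝ≥0∞) * d = 1 := by
    intro t d ht hd
    have : Fintype α := Fintype.ofFinite α
    rw [← t.tsum_coe, tsum_fintype, Set.ncard_eq_toFinset_card', ← nsmul_eq_mul,
      ← Finset.sum_const, ← Finset.sum_subset (Finset.subset_univ p.support.toFinset)]
    · exact Finset.sum_congr rfl fun x hx => (hd x (by rw [ht]; simpa using hx)).symm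
    · intro x _ hx
      rw [PMF.apply_eq_zero_iff, ht]
      simpa using hx
  have hab : a = b := by
    have h1 := hsum p a rfl hp
    have h2 := hsum r b h.symm hr
    rw [← ENNReal.mul_right_inj (a := (p.support.ncard : ℝ≥0∞)) (fun h0 => by simp [h0] at h1)
      (ENNReal.natCast_ne_top _), h1, h2]
  ext x
  by_cases hx : x ∈ p.support
  · rw [hp x hx, hr x (h ▸ hx), hab]
  · rw [(p.apply_eq_zero_iff x).2 hx, (r.apply_eq_zero_iff x).2 (h ▸ hx)]

namespace NestedCosetScheme

variable {K : Type*} [Field K] [Fintype K] {l n : ℕ}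

theorem mem_coset (E : NestedCosetScheme K l n) {S : Fin l → K} {x : Fin n → K} :
    x ∈ E.coset S ↔ ∃ h : x ∈ E.C₁, Submodule.Quotient.mk ⟨x, h⟩ = E.ψ S := by
  simp [coset]

/-- Each coset is a translate of `ψ 0` by any of its representatives. This makes the joint law
constant on its support. -/
theorem card_coset (E : NestedCosetScheme K l n) (S : Fin l → K) :
    (E.coset S).card = (E.coset 0).card := by
  obtain ⟨y, hy⟩ := E.coset_nonempty S
  obtain ⟨hy1, hy2⟩ := E.mem_coset.1 hy
  symm
  refine Finset.card_equiv (Equiv.addRight y) fun x => ?_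
  simp only [Equiv.coe_addRight, mem_coset, map_zero, ← hy2]
  constructor
  · rintro ⟨h, hx⟩
    refine ⟨E.C₁.add_mem h hy1, ?_⟩
    have hadd := Submodule.Quotient.mk_add (E.C₂.submoduleOf E.C₁) (x := ⟨x, h⟩) (y := ⟨y, hy1⟩)
    rwa [hx, zero_add] at hadd
  · rintro ⟨h, hx⟩
    refine ⟨by simpa using E.C₁.sub_mem h hy1, ?_⟩
    rw [← sub_eq_zero, ← Submodule.Quotient.mk_sub] at hx
    rw [← hx]
    congr 1
    ext1
    simp

theorem uniformLaw_apply (E : NestedCosetScheme K l n) (S : Fin l → K) (x : Fin n → K) :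
    E.uniformLaw (S, x) = (Fintype.card (Fin l → K) : ℝ≥0∞)⁻¹ *
      PMF.uniformOfFinset (E.coset S) (E.coset_nonempty S) x := by
  classical
  rw [uniformLaw, PMF.bind_apply, tsum_eq_single S]
  · rw [PMF.uniformOfFintype_apply]
    congr 1
    rw [PMF.map_apply, tsum_eq_single x]
    · simp
    · intro x' hx'
      simp [hx'.symm]
  · intro S' hS'
    rw [PMF.map_apply]
    simp [hS'.symm]

theorem mem_support_uniformLaw (E : NestedCosetScheme K l n) (p : (Fin l → K) × (Fin n → K)) :
    p ∈ E.uniformLaw.support ↔ p.2 ∈ E.coset p.1 := by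
  simp only [uniformLaw, PMF.mem_support_bind_iff, PMF.mem_support_map_iff,
    PMF.mem_support_uniformOfFinset_iff, PMF.mem_support_uniformOfFintype, true_and]
  constructor
  · rintro ⟨S, x, hx, rfl⟩
    exact hx
  · exact fun h => ⟨p.1, p.2, h, rfl⟩

end NestedCosetScheme

/-! ### Leakage and strength of the explicit scheme -/

section Explicit

variable {F K : Type*} [Field F] [Field K] [Fintype K] [Algebra F K] {l n k : ℕ}
  {D : Submodule K (Fin (l + n) → K)} {G : Matrix (Fin k) (Fin (l + n)) K}

/-- Subtracting the codeword with message part `S` and tail `S ΔG` reduces membership in the coset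
to membership in `C₂`, that is, to codewords with zero message part. -/
theorem mem_coset_proposedScheme (hl : 1 ≤ l) (hlk : l ≤ k) (hkn : k ≤ n)
    (hm : l + n ≤ Module.finrank F K) (hG : IsSystematicGenerator G D) (hD : IsMRD F D)
    {S : Fin l → K} {x : Fin n → K} :
    x ∈ (proposedScheme hl hlk hkn hm hG hD).coset S ↔
      ∃ c ∈ D, (fun i => c (Fin.castAdd n i)) = S ∧ (fun j => c (Fin.natAdd l j)) = x := by
  obtain ⟨g, hg, hg1, hg2⟩ := hG.exists_codeword hlk S
  rw [NestedCosetScheme.mem_coset]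
  have key : ∀ hx : x ∈ (proposedScheme hl hlk hkn hm hG hD).C₁,
      Submodule.Quotient.mk ⟨x, hx⟩ = (proposedScheme hl hlk hkn hm hG hD).ψ S ↔
        ∃ c ∈ D, (∀ i, c (Fin.castAdd n i) = 0) ∧
          ∀ j, c (Fin.natAdd l j) = x j - g (Fin.natAdd l j) := by
    intro hx
    refine (Submodule.Quotient.eq _).trans ?_
    rw [Submodule.submoduleOf, Submodule.mem_comap]
    refine mem_shorten_natAdd.trans ?_
    simp only [hg2]
    rfl
  constructor
  · rintro ⟨hx, h⟩
    obtain ⟨c, hc, h1, h2⟩ := (key hx).1 h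
    exact ⟨c + g, D.add_mem hc hg, funext fun i => by simp [h1, hg1],
      funext fun j => by simp [h2]⟩
  · rintro ⟨c, hc, rfl, rfl⟩
    exact ⟨⟨c, hc, rfl⟩, (key _).2 ⟨c - g, D.sub_mem hc hg, fun i => by simp [hg1],
      fun j => by simp⟩⟩

/-- Message and transmitted vector of the explicit scheme are the two parts of a uniform codeword
of `D`. -/
theorem uniformLaw_proposedScheme [Fintype D] (hl : 1 ≤ l) (hlk : l ≤ k) (hkn : k ≤ n)
    (hm : l + n ≤ Module.finrank F K) (hG : IsSystematicGenerator G D) (hD : IsMRD F D) :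
    (proposedScheme hl hlk hkn hm hG hD).uniformLaw = (PMF.uniformOfFintype D).map fun c =>
      (fun i => c.1 (Fin.castAdd n i), fun j => c.1 (Fin.natAdd l j)) := by
  classical
  set E := proposedScheme hl hlk hkn hm hG hD
  refine PMF.eq_of_support_eq_of_const
    (a := (Fintype.card (Fin l → K) : ℝ≥0∞)⁻¹ * ((E.coset 0).card : ℝ≥0∞)⁻¹)
    -- The factor `1` is the size of a fibre: a codeword is determined by its two parts.
    (b := 1 * (Fintype.card D : ℝ≥0∞)⁻¹) ?_ ?_ ?_
  · ext ⟨S, x⟩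
    rw [E.mem_support_uniformLaw, PMF.mem_support_map_iff]
    refine (mem_coset_proposedScheme hl hlk hkn hm hG hD).trans ?_
    simp [Prod.ext_iff, and_left_comm]
  · rintro ⟨S, x⟩ hx
    rw [E.mem_support_uniformLaw] at hx
    rw [E.uniformLaw_apply, PMF.uniformOfFinset_apply_of_mem _ hx, E.card_coset]
  · intro p hp
    obtain ⟨c, -, rfl⟩ := (PMF.mem_support_map_iff _ _ _).1 hp
    rw [map_uniformOfFintype_apply]
    congr 1
    rw [Nat.cast_eq_one, Finset.card_eq_one]
    refine ⟨c, Finset.ext fun d => ?_⟩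
    simp only [Finset.mem_filter, Finset.mem_univ, true_and, Finset.mem_singleton]
    refine ⟨fun h => Subtype.ext (funext fun t => ?_), fun h => h ▸ rfl⟩
    exact Fin.addCases (fun i => congrFun (congrArg Prod.fst h) i)
      (fun j => congrFun (congrArg Prod.snd h) j) t

/-- The observation `B Xᵀ` is independent of `S_Z` if and only if every value of the message
coordinates in `Z` is attained by a codeword with vanishing observation. -/
theorem leakage_proposedScheme_eq_zero_iff (hl : 1 ≤ l) (hlk : l ≤ k) (hkn : k ≤ n)
    (hm : l + n ≤ Module.finrank F K) (hG : IsSystematicGenerator G D) (hD : IsMRD F D)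
    (Z : Finset (Fin l)) {μ : ℕ} (B : Matrix (Fin μ) (Fin n) F) :
    (proposedScheme hl hlk hkn hm hG hD).leakage Z B = 0 ↔
      ∀ g ∈ D, ∃ c ∈ D, (∀ i : Z, c (Fin.castAdd n i) = g (Fin.castAdd n i)) ∧
        (B.map (algebraMap F K)).mulVec (fun j => c (Fin.natAdd l j)) = 0 := by
  have : Fintype D := Fintype.ofFinite D
  let φ : D →ₗ[K] (Z → K) :=
    LinearMap.funLeft K K (fun i : Z => Fin.castAdd n (i : Fin l)) ∘ₗ D.subtype
  let ψ : D →ₗ[K] (Fin μ → K) :=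
    ((B.map (algebraMap F K)).mulVecLin ∘ₗ LinearMap.funLeft K K (Fin.natAdd l)) ∘ₗ D.subtype
  have h := mutualInfo_map_uniform_eq_zero_iff (Fintype.card K : ℝ) φ.toAddMonoidHom
    ψ.toAddMonoidHom
  rw [NestedCosetScheme.leakage, uniformLaw_proposedScheme, PMF.map_comp]
  refine Iff.trans h ?_
  constructor
  · intro h g hg
    obtain ⟨c, h1, h2⟩ := h ⟨g, hg⟩
    exact ⟨c.1, c.2, fun i => congrFun h1 i, h2⟩
  · intro h g
    obtain ⟨c, hc, h1, h2⟩ := h g.1 g.2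
    exact ⟨⟨c, hc⟩, funext h1, h2⟩

/-- Here `k ≥ 1`, so `μ + |Z| = (k - 1) + 1` is exactly `dim D`, as `IsMRD.exists_codeword`
requires. -/
theorem isUniversallyStrong_proposedScheme (hl : 1 ≤ l) (hlk : l ≤ k) (hkn : k ≤ n)
    (hm : l + n ≤ Module.finrank F K) (hG : IsSystematicGenerator G D) (hD : IsMRD F D) :
    (proposedScheme hl hlk hkn hm hG hD).IsUniversallyStrong F (k - 1) := by
  intro Z μ hμ B
  have hk := hG.finrank_eq
  rw [leakage_proposedScheme_eq_zero_iff]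
  exact fun g _ => hD.exists_codeword hm (hk.trans_le hkn) Z (by omega) B _

theorem lt_of_isUniversallyStrong_proposedScheme (hl : 1 ≤ l) (hlk : l ≤ k) (hkn : k ≤ n)
    (hm : l + n ≤ Module.finrank F K) (hG : IsSystematicGenerator G D) (hD : IsMRD F D) {α : ℕ}
    (hα : (proposedScheme hl hlk hkn hm hG hD).IsUniversallyStrong F α) : α < k := by
  by_contra! hkα
  have hk := hG.finrank_eq
  -- `B` reads off the first `min α n ≥ k` coordinates of `X`; rows beyond the `n`-th are zero. A
  -- zero observation then forces the zero codeword, whose first message symbol cannot be `1`.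
  let B : Matrix (Fin α) (Fin n) F := Matrix.of fun i j => if (i : ℕ) = j then 1 else 0
  have h := hα {⟨0, hl⟩} α (by simp) B
  rw [leakage_proposedScheme_eq_zero_iff] at h
  obtain ⟨g, hg, hg1, -⟩ := hG.exists_codeword hlk (Pi.single ⟨0, hl⟩ 1)
  obtain ⟨c, hc, h1, h2⟩ := h g hg
  have hc0 : c = 0 := by
    refine hD.eq_zero_of_natAdd_eq_zero hm (hk.trans_le hkn) hc fun j hj => ?_
    have h3 := congrFun h2 ⟨j, by omega⟩
    simpa [B, Matrix.mulVec, dotProduct, apply_ite (algebraMap F K), Fin.val_inj] using h3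
  have h4 := h1 ⟨⟨0, hl⟩, by simp⟩
  rw [hg1, hc0] at h4
  simp at h4

end Explicit

theorem mainTheorem5 {F K : Type*} [Field F] [Finite F] [Field K] [Fintype K] [Algebra F K]
    {l n k : ℕ} (hl : 1 ≤ l) (hlk : l ≤ k) (hkn : k ≤ n) (hm : l + n ≤ Module.finrank F K)
    (D : Submodule K (Fin (l + n) → K)) (G : Matrix (Fin k) (Fin (l + n)) K)
    (hG : IsSystematicGenerator G D) (hD : IsMRD F D) :
    (proposedScheme hl hlk hkn hm hG hD).IsUniversalMaxStrength F (k - 1) ∧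
      k = Module.finrank K (proposedScheme hl hlk hkn hm hG hD).C₁ := by
  have hk := hG.finrank_eq
  refine ⟨⟨isUniversallyStrong_proposedScheme hl hlk hkn hm hG hD, fun α hα => ?_⟩, ?_⟩
  · have := lt_of_isUniversallyStrong_proposedScheme hl hlk hkn hm hG hD hα
    omega
  · exact hk.symm.trans (finrank_puncture hm hD (hk.trans_le hkn)).symm
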